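/- Consider a two-state Markov source $X_t\in\{0,1\}$ with $\Pr[X_{t+1}=1\mid X_t=0]=p$ and $\Pr[X_{t+1}=0\mid X_t=1]=q$, a battery of capacity $E_{\max}\in\mathbb N$, i.i.d. Bernoulli energy arrivals $b_t\in\{0,1\}$ with $\Pr[b_t=1]=\beta$, and a channel on which every transmission succeeds ($h_t=1$) independently with probability $p_s$ and fails with probability $p_f=1-p_s$; assume $0<p,q\le 1$, $0<\beta<1$, $0\le p_s\le 1$. In every slot a sensor chooses $\alpha_t\in\{0,1\}$ (idle or transmit); a transmission uses one unit of energy and does not occur if the battery is empty (then $\alpha_t=1$ acts as $\alpha_t=0$). The battery level evolves as $e_{t+1}=\min\{e_t+b_t-\alpha_t,E_{\max}\}$, and the Version Innovation Age $\Delta_t\in\{0,\dots,\Delta_{\max}\}$, $\Delta_{\max}\ge 1$, evolves as follows. After a successful transmission $\Delta_{t+1}=0$ if $X_{t+1}=X_t$ and $\Delta_{t+1}=1$ if $X_{t+1}\ne X_t$; otherwise (idle or failed transmission) $\Delta_{t+1}=\Delta_t$ if $X_{t+1}=X_t$ and $\Delta_{t+1}=\min\{\Delta_t+1,\Delta_{\max}\}$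 if $X_{t+1}\neq X_t$. Let $\mathfrak S$ be the set of states $S=(e,X,\Delta)$, and consider the problem of minimizing $\limsup_{T\to\infty}\frac1T E\big[\sum_{t=1}^{T}\Delta_t\,\big|\,S_1=s\big]$ over all causal (history-dependent, possibly randomized) policies. For $V:\mathfrak S\to\mathbb R$ put $V^a(S)=\sum_{S'}\Pr[S'\mid S,a]\,V(S')$ and $\Delta V(S)=V^1(S)-V^0(S)$. **Theorem.** The optimal policy is a threshold policy. Precisely, the Bellman equation $\theta+V(S)=\min_{a\in\{0,1\}}\{\Delta+V^a(S)\}$, $S=(e,X,\Delta)\in\mathfrak S$, has a solution $(\theta,V)$, and for every solution $(\theta,V)$: 1. the stationary policy that transmits in state $S$ if and only if $\Delta V(S)<0$ attains, from every initial state, the minimum of the average VIA over all causal policies, and this minimum is $\theta$; 2. $\Delta V(0,X,\Delta)=0$ for all $X,\Delta$, and $\Delta V(e,X,0)\ge 0$ for all $e,X$, so that this policy is idle when $e=0$ or $\Delta=0$; 3. for all $e,X$ the function $\Delta\mapsto\Delta V(e,X,\Delta)$ is non-increasing on $\{0,\dots,\Delta_{\max}\}$; 4. hence there are thresholds $\tau(e,X)\in\mathbb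 N$ such that the policy transmits in state $(e,X,\Delta)$ if and only if $e\ne 0$, $\Delta\ne 0$ and $\Delta\ge\tau(e,X)$ (a threshold larger than $\Delta_{\max}$ means that it never transmits at $(e,X)$). -/

import Mathlib

/-! The energy-harvesting remote-monitoring model with Version Innovation Age (VIA), and the
average-cost Markov decision process attached to it. -/

noncomputable section

namespace VIA

/-- The data of the model: battery capacity `E`, largest VIA value `D`, transition probabilities
`p` (from source state 0 to 1) and `q` (from 1 to 0), success probability `ps` of a transmission,
energy arrival probability `β`. -/
structure Params where
  E : ℕ
  D : ℕ
  p : unitInterval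
  q : unitInterval
  ps : unitInterval
  β : unitInterval

/-- States `(e, X, Δ)`; the source state `X` is a Boolean (`false` is state 0, `true` state 1). -/
abbrev State (M : Params) : Type := Fin (M.E + 1) × Bool × Fin (M.D + 1)

/-- The VIA `Δ` of a state, as a real number: this is the one-slot cost. -/
def via (M : Params) (s : State M) : ℝ := (s.2.2 : ℕ)

/-- A coin that shows `true` with probability `r`. -/
def coin (r : unitInterval) : PMF Bool :=
  PMF.ofFintype (fun b => ENNReal.ofReal (if b then (r : ℝ) else 1 - (r : ℝ))) (by
    rw [Fintype.sum_bool]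
    simp only [if_true, Bool.false_eq_true, if_false]
    rw [← ENNReal.ofReal_add r.2.1 (by linarith [r.2.2])]
    simp)

/-- The probability that the source leaves state `x`. -/
def flipProb (M : Params) (x : Bool) : unitInterval := if x then M.q else M.p

/-- Deterministic one-slot dynamics, given the action `a` (`true`: transmit), the energy arrival
`b`, whether the source changes state (`c`), and whether a transmission over the channel in this
slot would succeed (`h`). With an empty battery no transmission occurs. -/
def next (M : Params) (s : State M) (a b c h : Bool) : State M :=
  let tx : Bool := a && decide (s.1 ≠ 0)
  let e' : ℕ := min ((s.1 : ℕ) + b.toNat - tx.toNat) M.E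
  let d' : ℕ :=
    if tx && h then (if c then 1 else 0)
    else (if c then (s.2.2 : ℕ) + 1 else (s.2.2 : ℕ))
  (⟨e', Nat.lt_succ_of_le (min_le_right _ _)⟩, xor s.2.1 c,
    ⟨min d' M.D, Nat.lt_succ_of_le (min_le_right _ _)⟩)

/-- The transition law `Pr[· | s, a]`: arrival, source and channel are independent given `s`. -/
def trans (M : Params) (s : State M) (a : Bool) : PMF (State M) :=
  (coin M.β).bind fun b =>
    (coin (flipProb M s.2.1)).bind fun c =>
      (coin M.ps).bind fun h => PMF.pure (next M s a b c h)

/-! ### Policies and the average cost -/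

/-- The states and actions of the first `t` slots. -/
abbrev Hist (M : Params) (t : ℕ) : Type := Fin t → State M × Bool

/-- Causal policies: the (possibly randomized) action in a slot may depend on all past states and
actions and on the current state. -/
abbrev Policy (M : Params) : Type := (t : ℕ) → Hist M t → State M → PMF Bool

/-- The deterministic stationary policy given by a function of the state. -/
def stationary (M : Params) (f : State M → Bool) : Policy M := fun _ _ s => PMF.pure (f s)

/-- The joint law, under `π` and starting in `s`, of the history of the first `t` slots and the
state in the next one (slots are counted from 0, so that the initial state is that of slot 0). -/
def law (M : Params) (π : Policy M) (s : State M) : (t : ℕ) → PMF (Hist M t × State M)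
  | 0 => PMF.pure (Fin.elim0, s)
  | t + 1 =>
    (law M π s t).bind fun ω =>
      (π t ω.1 ω.2).bind fun a =>
        (trans M ω.2 a).map fun s' =>
          ((Fin.snoc ω.1 (ω.2, a) : Hist M (t + 1)), s')

/-- The expected VIA in slot `t` under `π`, starting in `s`. -/
def expVIA (M : Params) (π : Policy M) (s : State M) (t : ℕ) : ℝ :=
  ∑ ω : Hist M t × State M, (law M π s t ω).toReal * via M ω.2

/-- The long-run average VIA: `limsup_T (1/T) E[∑ Δ_t]`, the sum being over the first `T` slots. -/
def avgCost (M : Params) (π : Policy M) (s : State M) : ℝ :=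
  Filter.limsup (fun T : ℕ => (1 / (T : ℝ)) * ∑ t ∈ Finset.range T, expVIA M π s t) Filter.atTop

/-- `π` minimizes the average VIA over all causal policies, from every initial state. -/
def IsOptimal (M : Params) (π : Policy M) : Prop :=
  ∀ (s : State M) (π' : Policy M), avgCost M π s ≤ avgCost M π' s

/-! ### Bellman's equation and threshold policies -/

/-- `V^a(s) = ∑ s', Pr[s' | s, a] V(s')`. -/
def actVal (M : Params) (V : State M → ℝ) (a : Bool) (s : State M) : ℝ :=
  ∑ s' : State M, (trans M s a s').toReal * V s'

/-- The advantage `ΔV = V^1 - V^0`. -/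
def adv (M : Params) (V : State M → ℝ) (s : State M) : ℝ :=
  actVal M V true s - actVal M V false s

/-- `θ` and `V` solve the average-cost Bellman equation. -/
def IsBellmanSolution (M : Params) (θ : ℝ) (V : State M → ℝ) : Prop :=
  ∀ s : State M,
    θ + V s = min (via M s + actVal M V false s) (via M s + actVal M V true s)

open scoped Classical in
/-- The action chosen by `V`: transmit if and only if the advantage is negative. -/
def optAction (M : Params) (V : State M → ℝ) (s : State M) : Bool := decide (adv M V s < 0)

/-- Threshold rules: idle if the battery is empty or the VIA is zero; otherwise transmit exactly
when the VIA has reached a threshold that depends on the battery level and the source state (a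
threshold above `D` means that the rule never transmits there). -/
def IsThreshold (M : Params) (f : State M → Bool) : Prop :=
  ∃ τ : Fin (M.E + 1) → Bool → ℕ,
    ∀ (e : Fin (M.E + 1)) (x : Bool) (δ : Fin (M.D + 1)),
      f (e, x, δ) = true ↔ e ≠ 0 ∧ δ ≠ 0 ∧ τ e x ≤ (δ : ℕ)

end VIA

end

/-! The argument has three parts.

**Structure.** Every structural claim is proved for an arbitrary solution `V` of the Bellman
equation by a maximum principle: the largest violation of an inequality is attained at some state,
and one step of the Bellman equation, with the optimal actions of one state copied by the other,
shows that it is not positive. This avoids any uniqueness of `V`. In this way `V` is non-decreasing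
in the VIA (`ext_le_ext_succ`) and non-increasing in the battery level (`ext_succ_le_ext`). The
advantage is non-increasing in the VIA as soon as the increments of `V` in the VIA satisfy
`(1 - ps) * inc e ≤ inc (e + 1)` (`one_sub_ps_mul_inc_le`). That inequality does not propagate
through the Bellman equation on its own, but the family
`(1 - ps) ^ k * inc l ≤ inc (l + k)` does: whichever of the two actions are optimal at the states
involved, the violation at distance `k` is at most a mean of violations at distances `k - 1`, `k`
or `k + 1`, minus the cost difference `1 - (1 - ps) ^ k` (`defect_le_of_max`). This is strict for
`0 < ps`; for `ps = 0` the value function does not depend on the battery level.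

**Optimality.** Iterating the Bellman inequality along any policy, and the Bellman equation along
the policy chosen by `V`, telescopes to `T * θ` up to a bounded error.

**Existence.** For discount factors `γ < 1` the Bellman operator is a contraction. The span of the
fixed points is bounded uniformly in `γ` (`sub_le_span`): with the same actions, two different VIAs
merge after at most `D` flips of the source, and these do not depend on the policy; two neighbouring
battery levels cause no cost difference until they merge; and the source state is forgotten after
waiting for one flip. A limit point of the normalized fixed points as `γ → 1` is a solution. -/

namespace VIA

variable {M : Params}

/-! ### Expectations over finite types -/

/-- The expectation of a function under a probability mass function on a finite type; `actVal` and
`expVIA` are of this form. -/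
noncomputable def expect {α : Type*} [Fintype α] (μ : PMF α) (f : α → ℝ) : ℝ :=
  ∑ a, (μ a).toReal * f a

section expect

variable {α γ : Type*} [Fintype α] [Fintype γ]

lemma sum_toReal (μ : PMF α) : ∑ a, (μ a).toReal = 1 := by
  rw [← ENNReal.toReal_sum fun a _ => μ.apply_ne_top a, ← tsum_fintype (L := .unconditional α),
    μ.tsum_coe, ENNReal.toReal_one]

lemma expect_pure (a : α) (f : α → ℝ) : expect (PMF.pure a) f = f a := by
  classical
  unfold expect
  rw [Finset.sum_eq_single a]
  · simp
  · intro b _ hb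
    simp [PMF.pure_apply, hb]
  · simp

lemma expect_bind (μ : PMF α) (k : α → PMF γ) (f : γ → ℝ) :
    expect (μ.bind k) f = expect μ fun a => expect (k a) f := by
  unfold expect
  simp_rw [Finset.mul_sum]
  rw [Finset.sum_comm]
  refine Finset.sum_congr rfl fun c _ => ?_
  rw [PMF.bind_apply, tsum_fintype, ENNReal.toReal_sum
    fun a _ => ENNReal.mul_ne_top (μ.apply_ne_top a) ((k a).apply_ne_top c), Finset.sum_mul]
  refine Finset.sum_congr rfl fun a _ => ?_
  rw [ENNReal.toReal_mul, mul_assoc]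

lemma expect_map (μ : PMF α) (g : α → γ) (f : γ → ℝ) :
    expect (μ.map g) f = expect μ fun a => f (g a) := by
  rw [← PMF.bind_pure_comp, expect_bind]
  simp [expect_pure]

lemma expect_mono (μ : PMF α) {f g : α → ℝ} (h : ∀ a, f a ≤ g a) : expect μ f ≤ expect μ g :=
  Finset.sum_le_sum fun a _ => mul_le_mul_of_nonneg_left (h a) ENNReal.toReal_nonneg

lemma expect_const (μ : PMF α) (c : ℝ) : expect μ (fun _ => c) = c := by
  unfold expect
  rw [← Finset.sum_mul, sum_toReal, one_mul]

lemma expect_add (μ : PMF α) (f g : α → ℝ) :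
    expect μ (fun a => f a + g a) = expect μ f + expect μ g := by
  simp [expect, mul_add, Finset.sum_add_distrib]

lemma expect_sub (μ : PMF α) (f g : α → ℝ) :
    expect μ (fun a => f a - g a) = expect μ f - expect μ g := by
  simp [expect, mul_sub, Finset.sum_sub_distrib]

lemma expect_coin (r : unitInterval) (f : Bool → ℝ) :
    expect (coin r) f = r * f true + (1 - r) * f false := by
  have h : (0 : ℝ) ≤ 1 - r := sub_nonneg.2 r.2.2
  simp [expect, coin, ENNReal.toReal_ofReal, r.2.1, h]

end expect

/-! ### The one-slot dynamics in natural-number coordinates -/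

/-- The value function in natural-number coordinates: battery level and VIA are truncated at `E`
and `D`, so that the truncations in the dynamics need no separate treatment. -/
noncomputable def ext (V : State M → ℝ) (e : ℕ) (x : Bool) (d : ℕ) : ℝ :=
  V (⟨min e M.E, Nat.lt_succ_of_le (min_le_right _ _)⟩, x,
    ⟨min d M.D, Nat.lt_succ_of_le (min_le_right _ _)⟩)

lemma ext_coe (V : State M → ℝ) (e : Fin (M.E + 1)) (x : Bool) (d : Fin (M.D + 1)) :
    ext V e x d = V (e, x, d) := by
  have he : min (e : ℕ) M.E = e := min_eq_left (Nat.le_of_lt_succ e.2)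
  have hd : min (d : ℕ) M.D = d := min_eq_left (Nat.le_of_lt_succ d.2)
  simp [ext, he, hd]

lemma ext_congr (V : State M → ℝ) {e e' d d' : ℕ} (x : Bool) (he : min e M.E = min e' M.E)
    (hd : min d M.D = min d' M.D) : ext V e x d = ext V e' x d' := by
  simp [ext, he, hd]

/-- The mean over the energy arrival `b` and the source flip `c`, in source state `x`. -/
noncomputable def slotMean (M : Params) (x : Bool) (g : Bool → Bool → ℝ) : ℝ :=
  M.β * (flipProb M x * g true true + (1 - flipProb M x) * g true false) +
    (1 - M.β) * (flipProb M x * g false true + (1 - flipProb M x) * g false false)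

lemma slotMean_mono (x : Bool) {g k : Bool → Bool → ℝ} (h : ∀ b c, g b c ≤ k b c) :
    slotMean M x g ≤ slotMean M x k := by
  have h1 := M.β.2.1
  have h2 : (0 : ℝ) ≤ 1 - M.β := sub_nonneg.2 M.β.2.2
  have h3 := (flipProb M x).2.1
  have h4 : (0 : ℝ) ≤ 1 - flipProb M x := sub_nonneg.2 (flipProb M x).2.2
  unfold slotMean
  gcongr <;> apply h

lemma slotMean_le {x : Bool} {g : Bool → Bool → ℝ} {m : ℝ} (h : ∀ b c, g b c ≤ m) :
    slotMean M x g ≤ m := by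
  refine (slotMean_mono x (k := fun _ _ => m) h).trans_eq ?_
  unfold slotMean
  ring

lemma slotMean_sub (x : Bool) (g k : Bool → Bool → ℝ) :
    slotMean M x (fun b c => g b c - k b c) = slotMean M x g - slotMean M x k := by
  unfold slotMean
  ring

lemma slotMean_add (x : Bool) (g k : Bool → Bool → ℝ) :
    slotMean M x (fun b c => g b c + k b c) = slotMean M x g + slotMean M x k := by
  unfold slotMean
  ring

lemma slotMean_mul (x : Bool) (a : ℝ) (g : Bool → Bool → ℝ) :
    slotMean M x (fun b c => a * g b c) = a * slotMean M x g := by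
  unfold slotMean
  ring

/-- A bound that depends on the energy arrival only. -/
lemma slotMean_le_arrival {x : Bool} {g : Bool → Bool → ℝ} {m₀ m₁ : ℝ}
    (h₀ : ∀ c, g false c ≤ m₀) (h₁ : ∀ c, g true c ≤ m₁) :
    slotMean M x g ≤ M.β * m₁ + (1 - M.β) * m₀ := by
  refine (slotMean_mono x (k := fun b _ => if b then m₁ else m₀) ?_).trans_eq ?_
  · rintro (_ | _) c
    · simpa using h₀ c
    · simpa using h₁ c
  · simp only [slotMean, if_true, Bool.false_eq_true, if_false]
    ring

/-- A bound that depends on the source flip only. -/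
lemma slotMean_le_flip {x : Bool} {g : Bool → Bool → ℝ} {m₀ m₁ : ℝ}
    (h₀ : ∀ b, g b false ≤ m₀) (h₁ : ∀ b, g b true ≤ m₁) :
    slotMean M x g ≤ flipProb M x * m₁ + (1 - flipProb M x) * m₀ := by
  refine (slotMean_mono x (k := fun _ c => if c then m₁ else m₀) ?_).trans_eq ?_
  · rintro b (_ | _)
    · simpa using h₀ b
    · simpa using h₁ b
  · simp only [slotMean, if_true, Bool.false_eq_true, if_false]
    ring

/-- The expected value after idling with battery level `e`. -/
noncomputable def idleVal (V : State M → ℝ) (e : ℕ) (x : Bool) (d : ℕ) : ℝ :=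
  slotMean M x fun b c => ext V (e + b.toNat) (xor x c) (d + c.toNat)

/-- The expected value after transmitting with battery level `e + 1`, so that `e` units of energy
are left. -/
noncomputable def sendVal (V : State M → ℝ) (e : ℕ) (x : Bool) (d : ℕ) : ℝ :=
  slotMean M x fun b c => M.ps * ext V (e + b.toNat) (xor x c) c.toNat +
    (1 - M.ps) * ext V (e + b.toNat) (xor x c) (d + c.toNat)

lemma actVal_eq_expect (V : State M → ℝ) (a : Bool) (s : State M) :
    actVal M V a s = expect (trans M s a) V := rfl

lemma actVal_eq (V : State M → ℝ) (a : Bool) (s : State M) :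
    actVal M V a s = slotMean M s.2.1 fun b c =>
      M.ps * V (next M s a b c true) + (1 - M.ps) * V (next M s a b c false) := by
  simp only [actVal_eq_expect, trans, expect_bind, expect_pure, expect_coin, slotMean]

lemma actVal_false (V : State M → ℝ) (e : Fin (M.E + 1)) (x : Bool) (d : Fin (M.D + 1)) :
    actVal M V false (e, x, d) = idleVal V e x d := by
  rw [actVal_eq, idleVal]
  congr 1
  funext b c
  cases b <;> cases c <;> simp [next, ext] <;> ring

lemma actVal_true_zero (V : State M → ℝ) (x : Bool) (d : Fin (M.D + 1)) :
    actVal M V true (0, x, d) = actVal M V false (0, x, d) := by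
  simp [actVal_eq, next]

lemma actVal_true_of_eq_succ (V : State M → ℝ) {e : Fin (M.E + 1)} {n : ℕ} (he : (e : ℕ) = n + 1)
    (x : Bool) (d : Fin (M.D + 1)) : actVal M V true (e, x, d) = sendVal V n x d := by
  have h0 : e ≠ 0 := by
    rintro rfl
    simp at he
  rw [actVal_eq, sendVal]
  congr 1
  funext b c
  have hb : n + 1 + b.toNat - 1 = n + b.toNat := by omega
  cases c <;> simp [next, ext, h0, he, hb]

/-! ### The discounted Bellman equation -/

/-- The Bellman equation with discount factor `γ` and constant `θ`. For `γ = 1` it is the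
average-cost equation; for `γ < 1` and `θ = 0` it is the discounted one. -/
def IsDiscountedSolution (M : Params) (γ θ : ℝ) (V : State M → ℝ) : Prop :=
  ∀ s : State M,
    θ + V s = min (via M s + γ * actVal M V false s) (via M s + γ * actVal M V true s)

lemma IsBellmanSolution.discounted {θ : ℝ} {V : State M → ℝ} (h : IsBellmanSolution M θ V) :
    IsDiscountedSolution M 1 θ V := fun s => by
  simpa using h s

namespace IsDiscountedSolution

variable {γ θ : ℝ} {V : State M → ℝ}

lemma zero_eq (h : IsDiscountedSolution M γ θ V) (x : Bool) (d : ℕ) :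
    θ + ext V 0 x d = (min d M.D : ℕ) + γ * idleVal V 0 x d := by
  have hd : min d M.D < M.D + 1 := Nat.lt_succ_of_le (min_le_right _ _)
  have h1 := h (0, x, ⟨min d M.D, hd⟩)
  rw [actVal_true_zero, min_self, actVal_false, ← ext_coe V] at h1
  have h2 : ext V 0 x (min d M.D) = ext V 0 x d := ext_congr V x rfl (by simp)
  have h3 : idleVal V 0 x (min d M.D) = idleVal V 0 x d := by
    unfold idleVal
    congr 1
    funext b c
    exact ext_congr V _ rfl (by omega)
  simp only [Fin.val_zero, h2, h3, via] at h1
  exact h1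

lemma succ_eq (h : IsDiscountedSolution M γ θ V) {e : ℕ} (he : e + 1 ≤ M.E) (x : Bool) (d : ℕ) :
    θ + ext V (e + 1) x d = min ((min d M.D : ℕ) + γ * idleVal V (e + 1) x d)
      ((min d M.D : ℕ) + γ * sendVal V e x d) := by
  have hd : min d M.D < M.D + 1 := Nat.lt_succ_of_le (min_le_right _ _)
  have h1 := h (⟨e + 1, Nat.lt_succ_of_le he⟩, x, ⟨min d M.D, hd⟩)
  rw [actVal_true_of_eq_succ V rfl, actVal_false, ← ext_coe V] at h1
  have h2 : ext V (e + 1) x (min d M.D) = ext V (e + 1) x d := ext_congr V x rfl (by simp)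
  have h3 : idleVal V (e + 1) x (min d M.D) = idleVal V (e + 1) x d := by
    unfold idleVal
    congr 1
    funext b c
    exact ext_congr V _ rfl (by omega)
  have h4 : sendVal V e x (min d M.D) = sendVal V e x d := by
    unfold sendVal
    congr 1
    funext b c
    rw [ext_congr V (d := min d M.D + c.toNat) (d' := d + c.toNat) (xor x c) rfl (by omega)]
  simp only [h2, h3, h4, via] at h1
  exact h1

lemma le_idle (h : IsDiscountedSolution M γ θ V) {e : ℕ} (he : e ≤ M.E) (x : Bool) (d : ℕ) :
    θ + ext V e x d ≤ (min d M.D : ℕ) + γ * idleVal V e x d := by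
  rcases e with _ | e
  · exact (h.zero_eq x d).le
  · exact (h.succ_eq he x d).trans_le (min_le_left _ _)

lemma le_send (h : IsDiscountedSolution M γ θ V) {e : ℕ} (he : e + 1 ≤ M.E) (x : Bool) (d : ℕ) :
    θ + ext V (e + 1) x d ≤ (min d M.D : ℕ) + γ * sendVal V e x d :=
  (h.succ_eq he x d).trans_le (min_le_right _ _)

/-- In every state one of the two actions is optimal, and transmitting needs energy. -/
lemma cases_action (h : IsDiscountedSolution M γ θ V) {e : ℕ} (he : e ≤ M.E) (x : Bool) (d : ℕ) :
    θ + ext V e x d = (min d M.D : ℕ) + γ * idleVal V e x d ∨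
      ∃ n, e = n + 1 ∧ θ + ext V (n + 1) x d = (min d M.D : ℕ) + γ * sendVal V n x d := by
  rcases e with _ | e
  · exact .inl (h.zero_eq x d)
  · rw [h.succ_eq he x d]
    rcases min_choice ((min d M.D : ℕ) + γ * idleVal V (e + 1) x d)
      ((min d M.D : ℕ) + γ * sendVal V e x d) with h1 | h1
    · exact .inl h1
    · exact .inr ⟨e, rfl, by rw [h.succ_eq he x d, h1]⟩

end IsDiscountedSolution

/-! ### Monotonicity of the value function -/

lemma ps_nonneg : (0 : ℝ) ≤ M.ps := M.ps.2.1

lemma one_sub_ps_nonneg : (0 : ℝ) ≤ 1 - M.ps := sub_nonneg.2 M.ps.2.2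

/-- A function on a finite grid attains its maximum. -/
lemma exists_max_grid (N K : ℕ) (f : ℕ → ℕ → Bool → ℕ → ℝ) :
    ∃ l k x d, l + k ≤ N ∧ d ≤ K ∧
      ∀ l' k' x' d', l' + k' ≤ N → d' ≤ K → f l' k' x' d' ≤ f l k x d := by
  let S : Finset (ℕ × ℕ × Bool × ℕ) :=
    (Finset.range (N + 1) ×ˢ Finset.range (N + 1) ×ˢ Finset.univ ×ˢ Finset.range (K + 1)).filter
      fun i => i.1 + i.2.1 ≤ N
  have hS : ∀ l k x d, (l, k, x, d) ∈ S ↔ l + k ≤ N ∧ d ≤ K := by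
    intro l k x d
    simp only [S, Finset.mem_filter, Finset.mem_product, Finset.mem_range, Finset.mem_univ,
      true_and]
    omega
  obtain ⟨⟨l, k, x, d⟩, h1, h2⟩ := S.exists_max_image (fun i => f i.1 i.2.1 i.2.2.1 i.2.2.2)
    ⟨(0, 0, true, 0), (hS _ _ _ _).2 (by omega)⟩
  obtain ⟨h3, h4⟩ := (hS _ _ _ _).1 h1
  exact ⟨l, k, x, d, h3, h4, fun l' k' x' d' h5 h6 => h2 (l', k', x', d') ((hS _ _ _ _).2 ⟨h5, h6⟩)⟩

/-- A function of the VIA that is constant beyond `K` attains its maximum over battery levels up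
to `N`, source states and all VIA values. -/
lemma exists_max_of_cap (N K : ℕ) (f : ℕ → Bool → ℕ → ℝ)
    (hf : ∀ e x d, f e x (min d K) = f e x d) :
    ∃ e x d, e ≤ N ∧ ∀ e' x' d', e' ≤ N → f e' x' d' ≤ f e x d := by
  obtain ⟨l, k, x, d, h1, -, h3⟩ := exists_max_grid N K fun l _ x d => f l x d
  refine ⟨l, x, d, by omega, fun e' x' d' h => ?_⟩
  rw [← hf]
  exact h3 e' 0 x' _ h (min_le_right _ _)

namespace IsDiscountedSolution

variable {γ θ : ℝ} {V : State M → ℝ}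

/-- The value function is non-decreasing in the VIA: copying the optimal actions of the state with
the larger VIA costs less in the current slot and preserves the order of the VIAs. -/
lemma ext_le_ext_succ (h : IsDiscountedSolution M γ θ V) (hγ0 : 0 ≤ γ) (hγ1 : γ ≤ 1) (e : ℕ)
    (x : Bool) (d : ℕ) : ext V e x d ≤ ext V e x (d + 1) := by
  obtain ⟨e₀, x₀, d₀, he₀, hmax⟩ := exists_max_of_cap M.E M.D
    (fun e x d => ext V e x d - ext V e x (d + 1)) fun e x d => by
      rw [ext_congr V (d := min d M.D) (d' := d) x rfl (by simp),
        ext_congr V (d := min d M.D + 1) (d' := d + 1) x rfl (by omega)]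
  set m := ext V e₀ x₀ d₀ - ext V e₀ x₀ (d₀ + 1) with hm
  have hmax' : ∀ e x d, ext V e x d - ext V e x (d + 1) ≤ m := fun e x d => by
    rw [ext_congr V (e := e) (e' := min e M.E) x (by simp) (rfl : min d M.D = _),
      ext_congr V (e := e) (e' := min e M.E) x (by simp) (rfl : min (d + 1) M.D = _)]
    exact hmax _ _ _ (min_le_right _ _)
  have hm0 : 0 ≤ m := by
    refine le_of_eq_of_le ?_ (hmax' 0 true M.D)
    rw [ext_congr V (d := M.D + 1) (d' := M.D) true rfl (by simp), sub_self]
  suffices hm1 : m ≤ 0 by linarith [hmax' e x d]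
  rcases le_or_gt M.D d₀ with hd | hd
  · rw [hm, ext_congr V (d := d₀ + 1) (d' := d₀) x₀ rfl (by omega), sub_self]
  have hc1 : ((min d₀ M.D : ℕ) : ℝ) = d₀ := by rw [min_eq_left hd.le]
  have hc2 : ((min (d₀ + 1) M.D : ℕ) : ℝ) = d₀ + 1 := by rw [min_eq_left hd]; push_cast; rfl
  have hγm : γ * m ≤ m := mul_le_of_le_one_left hm0 hγ1
  rcases h.cases_action he₀ x₀ (d₀ + 1) with h1 | ⟨n, rfl, h1⟩
  · have h2 := h.le_idle he₀ x₀ d₀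
    have h3 : idleVal V e₀ x₀ d₀ - idleVal V e₀ x₀ (d₀ + 1) ≤ m := by
      rw [idleVal, idleVal, ← slotMean_sub]
      refine slotMean_le fun b c => ?_
      rw [add_right_comm]
      exact hmax' _ _ _
    have h4 := mul_le_mul_of_nonneg_left h3 hγ0
    linarith
  · have h2 := h.le_send he₀ x₀ d₀
    have h3 : sendVal V n x₀ d₀ - sendVal V n x₀ (d₀ + 1) ≤ m := by
      rw [sendVal, sendVal, ← slotMean_sub]
      refine slotMean_le fun b c => ?_
      rw [add_right_comm d₀]
      have h5 := mul_le_mul_of_nonneg_left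
        (hmax' (n + b.toNat) (xor x₀ c) (d₀ + c.toNat)) (one_sub_ps_nonneg (M := M))
      have h6 := mul_nonneg (ps_nonneg (M := M)) hm0
      linarith
    have h4 := mul_le_mul_of_nonneg_left h3 hγ0
    linarith

lemma monotone_ext (h : IsDiscountedSolution M γ θ V) (hγ0 : 0 ≤ γ) (hγ1 : γ ≤ 1) (e : ℕ)
    (x : Bool) : Monotone (ext V e x) :=
  monotone_nat_of_le_succ fun d => h.ext_le_ext_succ hγ0 hγ1 e x d

/-- The value function is non-increasing in the battery level. While the emptier battery is used
optimally, the fuller one either transmits where the other idles, after which the levels agree and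
its VIA is no larger, or it transmits as well. In the second case the emptier battery is
drained by one unit unless energy arrives, so the inequality at the next lower level and the
strict contraction by `β` give the claim. -/
lemma ext_succ_le_ext (h : IsDiscountedSolution M γ θ V) (hγ0 : 0 ≤ γ) (hγ1 : γ ≤ 1)
    (hβ1 : M.β < 1) (e : ℕ) (x : Bool) (d : ℕ) : ext V (e + 1) x d ≤ ext V e x d := by
  induction e generalizing x d with
  | zero =>
    rcases Nat.eq_zero_or_pos M.E with hE | hE
    · exact (ext_congr V x (by simp [hE]) rfl).le
    have h1 := h.zero_eq x d
    have h2 := h.le_send (e := 0) hE x d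
    have h3 : sendVal V 0 x d ≤ idleVal V 0 x d := by
      refine slotMean_mono x fun b c => ?_
      have h4 := h.monotone_ext hγ0 hγ1 (0 + b.toNat) (xor x c)
        (show c.toNat ≤ d + c.toNat by omega)
      nlinarith [ps_nonneg (M := M)]
    linarith [mul_le_mul_of_nonneg_left h3 hγ0]
  | succ n ih =>
    rcases le_or_gt M.E (n + 1) with hE | hE
    · exact (ext_congr V x (by omega) rfl).le
    obtain ⟨-, x₀, d₀, -, hmax⟩ := exists_max_of_cap 0 M.D
      (fun _ x d => ext V (n + 1 + 1) x d - ext V (n + 1) x d) fun e x d => by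
        rw [ext_congr V (d := min d M.D) (d' := d) x rfl (by simp),
          ext_congr V (d := min d M.D) (d' := d) x rfl (by simp)]
    replace hmax := fun x d => hmax 0 x d le_rfl
    set m := ext V (n + 1 + 1) x₀ d₀ - ext V (n + 1) x₀ d₀ with hm
    suffices hm0 : m ≤ 0 by linarith [hmax x d]
    by_contra! hm0
    rcases h.cases_action hE.le x₀ d₀ with h1 | ⟨k, hk, h1⟩
    · have h2 := h.le_send hE x₀ d₀
      have h3 : sendVal V (n + 1) x₀ d₀ ≤ idleVal V (n + 1) x₀ d₀ := by
        refine slotMean_mono x₀ fun b c => ?_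
        have h4 := h.monotone_ext hγ0 hγ1 (n + 1 + b.toNat) (xor x₀ c)
          (show c.toNat ≤ d₀ + c.toNat by omega)
        nlinarith [ps_nonneg (M := M)]
      linarith [mul_le_mul_of_nonneg_left h3 hγ0]
    · obtain rfl : n = k := by omega
      have h2 := h.le_send hE x₀ d₀
      have h3 : sendVal V (n + 1) x₀ d₀ - sendVal V n x₀ d₀ ≤ M.β * m + (1 - M.β) * 0 := by
        rw [sendVal, sendVal, ← slotMean_sub]
        have h5 := ps_nonneg (M := M)
        have h6 := one_sub_ps_nonneg (M := M)
        refine slotMean_le_arrival (fun c => ?_) (fun c => ?_)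
        · have h7 := mul_le_mul_of_nonneg_left (ih (xor x₀ c) c.toNat) h5
          have h8 := mul_le_mul_of_nonneg_left (ih (xor x₀ c) (d₀ + c.toNat)) h6
          simp only [Bool.toNat_false, add_zero]
          linarith
        · have h7 := mul_le_mul_of_nonneg_left (hmax (xor x₀ c) c.toNat) h5
          have h8 := mul_le_mul_of_nonneg_left (hmax (xor x₀ c) (d₀ + c.toNat)) h6
          simp only [Bool.toNat_true]
          linarith
      have h4 := mul_le_mul_of_nonneg_left h3 hγ0
      have hβ : (M.β : ℝ) < 1 := hβ1
      have h5 : M.β * m < m := by nlinarith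
      have h6 : γ * (M.β * m) ≤ M.β * m :=
        mul_le_of_le_one_left (mul_nonneg M.β.2.1 hm0.le) hγ1
      linarith

lemma antitone_ext (h : IsDiscountedSolution M γ θ V) (hγ0 : 0 ≤ γ) (hγ1 : γ ≤ 1)
    (hβ1 : M.β < 1) (x : Bool) (d : ℕ) : Antitone fun e => ext V e x d :=
  antitone_nat_of_succ_le fun e => h.ext_succ_le_ext hγ0 hγ1 hβ1 e x d

end IsDiscountedSolution

/-! ### Comparing VIA increments across battery levels -/

/-- The increment of the value function when the VIA grows from `d` to `d + 1`. -/
noncomputable def inc (V : State M → ℝ) (e : ℕ) (x : Bool) (d : ℕ) : ℝ :=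
  ext V e x (d + 1) - ext V e x d

lemma inc_of_le (V : State M → ℝ) {d : ℕ} (hd : M.D ≤ d) (e : ℕ) (x : Bool) : inc V e x d = 0 := by
  rw [inc, ext_congr V (d := d + 1) (d' := d) x rfl (by omega), sub_self]

lemma inc_congr (V : State M → ℝ) {e e' d d' : ℕ} (x : Bool) (he : min e M.E = min e' M.E)
    (hd : min d M.D = min d' M.D) : inc V e x d = inc V e' x d' := by
  rw [inc, inc, ext_congr V x he hd, ext_congr V (d := d + 1) (d' := d' + 1) x he (by omega)]

/-- The defect `(1 - ps) ^ k * inc l - inc (l + k)` in the comparison of the increments at battery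
levels `l` and `l + k`. -/
noncomputable def defect (V : State M → ℝ) (l k : ℕ) (x : Bool) (d : ℕ) : ℝ :=
  (1 - M.ps : ℝ) ^ k * inc V l x d - inc V (l + k) x d

namespace IsDiscountedSolution

variable {θ : ℝ} {V : State M → ℝ}

lemma inc_nonneg (h : IsDiscountedSolution M 1 θ V) (e : ℕ) (x : Bool) (d : ℕ) :
    0 ≤ inc V e x d :=
  sub_nonneg.2 (h.ext_le_ext_succ zero_le_one le_rfl e x d)

/-- Over a channel on which every transmission fails, idling is always optimal, and by downward
induction from the full battery the value function does not depend on the battery level. -/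
lemma ext_le_ext_of_ps_eq_zero (h : IsDiscountedSolution M 1 θ V) (hβ0 : 0 < M.β) (hβ1 : M.β < 1)
    (hps : (M.ps : ℝ) = 0) (j : ℕ) : ∀ e x d, M.E ≤ e + j → ext V e x d ≤ ext V (e + 1) x d := by
  induction j with
  | zero => exact fun e x d he => (ext_congr V x (by omega) rfl).le
  | succ j ih =>
    intro e x d he
    rcases le_or_gt M.E e with hE | hE
    · exact (ext_congr V x (by omega) rfl).le
    obtain ⟨-, x₀, d₀, -, hmax⟩ := exists_max_of_cap 0 M.D
      (fun _ x d => ext V e x d - ext V (e + 1) x d) fun _ x d => by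
        rw [ext_congr V (d := min d M.D) (d' := d) x rfl (by simp),
          ext_congr V (d := min d M.D) (d' := d) x rfl (by simp)]
    replace hmax := fun x d => hmax 0 x d le_rfl
    set m := ext V e x₀ d₀ - ext V (e + 1) x₀ d₀ with hm
    suffices hm0 : m ≤ 0 by linarith [hmax x d]
    have h1 : θ + ext V (e + 1) x₀ d₀ ≥ (min d₀ M.D : ℕ) + idleVal V (e + 1) x₀ d₀ := by
      rcases h.cases_action hE x₀ d₀ with h1 | ⟨n, hn, h1⟩
      · linarith
      · obtain rfl : e = n := by omega
        have h2 : idleVal V (e + 1) x₀ d₀ ≤ sendVal V e x₀ d₀ := by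
          refine slotMean_mono x₀ fun b c => ?_
          rw [hps, zero_mul, zero_add, sub_zero, one_mul]
          exact h.antitone_ext zero_le_one le_rfl hβ1 _ _ (by omega)
        linarith
    have h2 := h.le_idle hE.le x₀ d₀
    have h3 : idleVal V e x₀ d₀ - idleVal V (e + 1) x₀ d₀ ≤ M.β * 0 + (1 - M.β) * m := by
      rw [idleVal, idleVal, ← slotMean_sub]
      refine slotMean_le_arrival (fun c => hmax _ _) (fun c => ?_)
      exact sub_nonpos.2 (ih (e + 1) _ _ (by omega))
    have hβ : (0 : ℝ) < M.β := hβ0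
    nlinarith

/-- If `m` bounds all defects, the defect at distance `k + 1` is below `m` by at least the difference
`1 - (1 - ps) ^ (k + 1)` of the current costs. The state `(l + k + 1, d)` is compared with
`(l + k + 1, d + 1)` and the state `(l, d + 1)` with `(l, d)`, the first of each pair using the action
that is optimal for the second; in all four combinations of actions what remains is a
mean of defects in the next slot, possibly scaled by `1 - ps`, at distance `k`, `k + 1` or `k + 2`. -/
lemma defect_le_of_max (h : IsDiscountedSolution M 1 θ V) {m : ℝ} (hm0 : 0 ≤ m)
    (hmax : ∀ l k x d, l ≤ M.E → defect V l k x d ≤ m) {l k : ℕ} (hlk : l + (k + 1) ≤ M.E) (x : Bool)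
    {d : ℕ} (hd : d < M.D) :
    defect V l (k + 1) x d ≤ m - (1 - (1 - M.ps : ℝ) ^ (k + 1)) := by
  have hp0 := ps_nonneg (M := M)
  have hf0 := one_sub_ps_nonneg (M := M)
  have hfk : (0 : ℝ) ≤ (1 - M.ps : ℝ) ^ (k + 1) := pow_nonneg hf0 _
  have hc1 : ((min d M.D : ℕ) : ℝ) = d := by rw [min_eq_left hd.le]
  have hc2 : ((min (d + 1) M.D : ℕ) : ℝ) = d + 1 := by rw [min_eq_left hd]; push_cast; rfl
  have hfm : (1 - M.ps : ℝ) * m ≤ m := by nlinarith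
  -- It suffices to bound the mean of what follows the chosen actions.
  suffices hmain : ∃ u₁ u₂ w₁ w₂ : Bool → Bool → ℝ,
      θ + ext V (l + (k + 1)) x d ≤ d + slotMean M x u₁ ∧
      θ + ext V l x (d + 1) ≤ (d + 1) + slotMean M x u₂ ∧
      θ + ext V (l + (k + 1)) x (d + 1) = (d + 1) + slotMean M x w₁ ∧
      θ + ext V l x d = d + slotMean M x w₂ ∧
      ∀ b c, u₁ b c + (1 - M.ps : ℝ) ^ (k + 1) * u₂ b c -
        (w₁ b c + (1 - M.ps : ℝ) ^ (k + 1) * w₂ b c) ≤ m by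
    obtain ⟨u₁, u₂, w₁, w₂, h1, h2, h3, h4, h5⟩ := hmain
    have h6 := slotMean_le (M := M) (x := x) h5
    rw [slotMean_sub, slotMean_add, slotMean_add, slotMean_mul, slotMean_mul] at h6
    have h7 := mul_le_mul_of_nonneg_left h2 hfk
    have h8 := congrArg ((1 - M.ps : ℝ) ^ (k + 1) * ·) h4
    simp only [defect, inc]
    linarith
  have e1 := h.cases_action hlk x (d + 1)
  have e2 := h.cases_action (show l ≤ M.E by omega) x d
  rw [hc2, ← add_assoc l k 1] at e1
  rw [hc1] at e2
  have i1 := h.le_idle hlk x d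
  have i2 := h.le_idle (show l ≤ M.E by omega) x (d + 1)
  have s1 := h.le_send (e := l + k) hlk x d
  rw [hc1] at i1 s1
  rw [hc2] at i2
  simp only [one_mul] at e1 e2 i1 i2 s1
  rcases e1 with e1 | ⟨n, hn, e1⟩ <;> rcases e2 with e2 | ⟨n', rfl, e2⟩
  · refine ⟨_, _, _, _, i1, i2, e1, e2, fun b c => ?_⟩
    have hb := hmax (l + b.toNat) (k + 1) (xor x c) (d + c.toNat)
      (by have := b.toNat_le; omega)
    simp only [defect, inc, show l + b.toNat + (k + 1) = l + k + 1 + b.toNat by omega] at hb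
    simp only [show l + (k + 1) = l + k + 1 by omega, add_right_comm d 1]
    linarith
  · have s2 := h.le_send (e := n') (by omega) x (d + 1)
    rw [hc2, one_mul] at s2
    refine ⟨_, _, _, _, i1, s2, e1, e2, fun b c => ?_⟩
    have hb := hmax (n' + b.toNat) (k + 2) (xor x c) (d + c.toNat)
      (by have := b.toNat_le; omega)
    simp only [defect, inc, show n' + b.toNat + (k + 2) = n' + 1 + k + 1 + b.toNat by omega,
      pow_succ _ (k + 1)] at hb
    simp only [show n' + 1 + (k + 1) = n' + 1 + k + 1 by omega, add_right_comm d 1]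
    linarith
  · obtain rfl : l + k = n := by omega
    refine ⟨_, _, _, _, s1, i2, e1, e2, fun b c => ?_⟩
    have hb := hmax (l + b.toNat) k (xor x c) (d + c.toNat)
      (by have := b.toNat_le; omega)
    have hb' := (mul_le_mul_of_nonneg_left hb hf0).trans hfm
    simp only [defect, inc, show l + b.toNat + k = l + k + b.toNat by omega] at hb'
    simp only [pow_succ, add_right_comm d 1]
    linarith
  · obtain rfl : n' + 1 + k = n := by omega
    have s2 := h.le_send (e := n') (by omega) x (d + 1)
    rw [hc2, one_mul] at s2
    refine ⟨_, _, _, _, s1, s2, e1, e2, fun b c => ?_⟩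
    have hb := hmax (n' + b.toNat) (k + 1) (xor x c) (d + c.toNat)
      (by have := b.toNat_le; omega)
    have hb' := (mul_le_mul_of_nonneg_left hb hf0).trans hfm
    simp only [defect, inc, show n' + b.toNat + (k + 1) = n' + 1 + k + b.toNat by omega] at hb'
    simp only [add_right_comm d 1]
    linarith

/-- The increments in the VIA at neighbouring battery levels. With only neighbouring levels in the
comparison the maximum principle fails, as two defects appear on the right when the fuller battery
idles and the emptier one transmits. Hence the defect is maximized over pairs of levels at any
distance. -/
lemma one_sub_ps_mul_inc_le (h : IsDiscountedSolution M 1 θ V) (hβ0 : 0 < M.β) (hβ1 : M.β < 1)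
    {e : ℕ} (he : e ≤ M.E) (x : Bool) (d : ℕ) :
    (1 - M.ps : ℝ) * inc V e x d ≤ inc V (e + 1) x d := by
  have hf0 := one_sub_ps_nonneg (M := M)
  have hf1 : (1 - M.ps : ℝ) ≤ 1 := by linarith [ps_nonneg (M := M)]
  rcases (ps_nonneg (M := M)).eq_or_lt with hps | hps
  · have hE : ∀ d, ext V (e + 1) x d = ext V e x d := fun d =>
      le_antisymm (h.ext_succ_le_ext zero_le_one le_rfl hβ1 e x d)
        (h.ext_le_ext_of_ps_eq_zero hβ0 hβ1 hps.symm M.E e x d (by omega))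
    rw [← hps, sub_zero, one_mul, inc, inc, hE, hE]
  obtain ⟨l, k, x₀, d₀, hlk, -, hmax⟩ := exists_max_grid M.E M.D (defect V)
  set m := defect V l k x₀ d₀ with hm
  have hzero : ∀ l k x, ∀ d, M.D ≤ d → defect V l k x d = 0 := fun l k x d hd => by
    rw [defect, inc_of_le V hd, inc_of_le V hd, mul_zero, sub_zero]
  have hm0 : 0 ≤ m := by
    rw [← hzero 0 0 true M.D le_rfl]
    exact hmax 0 0 true M.D (by omega) le_rfl
  -- Beyond the capacity the exponent grows while both levels stay the same.
  have hmax' : ∀ l k x d, l ≤ M.E → defect V l k x d ≤ m := by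
    intro l k x d hl
    rcases le_or_gt M.D d with hd | hd
    · rw [hzero l k x d hd]
      exact hm0
    rcases le_or_gt (l + k) M.E with h1 | h1
    · exact hmax l k x d h1 hd.le
    · refine le_trans ?_ (hmax l (M.E - l) x d (by omega) hd.le)
      rw [defect, defect, inc_congr V (e := l + k) (e' := l + (M.E - l)) x (by omega) rfl]
      have h2 := pow_le_pow_of_le_one hf0 hf1 (show M.E - l ≤ k by omega)
      linarith [mul_le_mul_of_nonneg_right h2 (h.inc_nonneg l x d)]
  have hm1 : m ≤ 0 := by
    rcases le_or_gt M.D d₀ with hd | hd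
    · exact (hzero l k x₀ d₀ hd).le
    rcases k with _ | k
    · rw [hm, defect]
      simp
    · have h1 := h.defect_le_of_max hm0 hmax' hlk x₀ hd
      have h2 : (1 - M.ps : ℝ) ^ (k + 1) < 1 := pow_lt_one₀ hf0 (by linarith) (by omega)
      linarith
  have h1 := (hmax' e 1 x d he).trans hm1
  rw [defect, pow_one] at h1
  linarith

end IsDiscountedSolution

/-! ### The advantage of transmitting -/

lemma adv_of_eq_succ (V : State M → ℝ) {e : Fin (M.E + 1)} {n : ℕ} (he : (e : ℕ) = n + 1) (x : Bool)
    (d : Fin (M.D + 1)) : adv M V (e, x, d) = sendVal V n x d - idleVal V (n + 1) x d := by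
  rw [adv, actVal_true_of_eq_succ V he, actVal_false, he]

lemma adv_zero (V : State M → ℝ) (x : Bool) (d : Fin (M.D + 1)) : adv M V (0, x, d) = 0 := by
  rw [adv, actVal_true_zero, sub_self]

namespace IsBellmanSolution

variable {θ : ℝ} {V : State M → ℝ}

lemma adv_nonneg (h : IsBellmanSolution M θ V) (hβ1 : M.β < 1) (e : Fin (M.E + 1)) (x : Bool) :
    0 ≤ adv M V (e, x, 0) := by
  rcases hn : (e : ℕ) with _ | n
  · obtain rfl : e = 0 := Fin.ext hn
    rw [adv_zero]
  · rw [adv_of_eq_succ V hn, sub_nonneg]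
    refine slotMean_mono x fun b c => ?_
    have h1 := h.discounted.ext_succ_le_ext zero_le_one le_rfl hβ1 (n + b.toNat) (xor x c) c.toNat
    simp only [Fin.val_zero, zero_add, add_right_comm n 1]
    linarith

lemma adv_antitone (h : IsBellmanSolution M θ V) (hβ0 : 0 < M.β) (hβ1 : M.β < 1)
    (e : Fin (M.E + 1)) (x : Bool) : Antitone fun d : Fin (M.D + 1) => adv M V (e, x, d) := by
  rcases hn : (e : ℕ) with _ | n
  · obtain rfl : e = 0 := Fin.ext hn
    simp only [adv_zero]
    exact antitone_const
  · simp only [adv_of_eq_succ V hn]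
    have hanti : Antitone fun d => sendVal V n x d - idleVal V (n + 1) x d := by
      refine antitone_nat_of_succ_le fun d => ?_
      simp only [sendVal, idleVal, ← slotMean_sub]
      refine slotMean_mono x fun b c => ?_
      have hE : n + b.toNat ≤ M.E := by
        have := b.toNat_le
        omega
      have h1 := h.discounted.one_sub_ps_mul_inc_le hβ0 hβ1 hE (xor x c) (d + c.toNat)
      simp only [inc] at h1
      simp only [add_right_comm n 1, add_right_comm d 1]
      linarith
    exact fun d d' hd => hanti hd

lemma isThreshold (h : IsBellmanSolution M θ V) (hβ0 : 0 < M.β) (hβ1 : M.β < 1) :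
    IsThreshold M (optAction M V) := by
  -- The threshold is the least strict upper bound of the VIA values at which idling is optimal.
  refine ⟨fun e x => sInf {n : ℕ | ∀ d : Fin (M.D + 1), 0 ≤ adv M V (e, x, d) → (d : ℕ) < n},
    fun e x d => ?_⟩
  set S := {n : ℕ | ∀ d : Fin (M.D + 1), 0 ≤ adv M V (e, x, d) → (d : ℕ) < n} with hS
  have hmem : sInf S ∈ S := Nat.sInf_mem ⟨M.D + 1, fun d _ => d.2⟩
  simp only [optAction, decide_eq_true_eq]
  constructor
  · intro hd
    refine ⟨?_, ?_, Nat.sInf_le fun d' hd' => ?_⟩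
    · rintro rfl
      exact hd.ne (adv_zero V x d)
    · rintro rfl
      exact hd.not_ge (h.adv_nonneg hβ1 e x)
    · by_contra! hle
      exact (hd'.trans (h.adv_antitone hβ0 hβ1 e x (Fin.le_def.2 hle))).not_gt hd
  · rintro ⟨-, -, hle⟩
    by_contra! hd
    exact (hmem d hd).not_ge hle

end IsBellmanSolution

/-! ### Verification: Bellman solutions determine the optimal average cost -/

lemma expVIA_eq_expect (π : Policy M) (s : State M) (t : ℕ) :
    expVIA M π s t = expect (law M π s t) fun ω => via M ω.2 := rfl

lemma via_nonneg (s : State M) : 0 ≤ via M s := Nat.cast_nonneg _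

lemma via_le (s : State M) : via M s ≤ M.D := Nat.cast_le.2 (Nat.le_of_lt_succ s.2.2.2)

lemma expVIA_le (π : Policy M) (s : State M) (t : ℕ) : expVIA M π s t ≤ M.D := by
  rw [expVIA_eq_expect, ← expect_const (law M π s t) M.D]
  exact expect_mono _ fun ω => via_le _

lemma expect_law_zero (π : Policy M) (s : State M) (V : State M → ℝ) :
    expect (law M π s 0) (fun ω => V ω.2) = V s :=
  expect_pure _ _

lemma expect_law_succ (π : Policy M) (s : State M) (t : ℕ) (V : State M → ℝ) :
    expect (law M π s (t + 1)) (fun ω => V ω.2) =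
      expect (law M π s t) fun ω => expect (π t ω.1 ω.2) fun a => actVal M V a ω.2 := by
  simp only [law, expect_bind, expect_map, actVal_eq_expect]

lemma exists_abs_le (V : State M → ℝ) : ∃ B, ∀ s, |V s| ≤ B := by
  obtain ⟨s₀, hs₀⟩ := Finite.exists_max fun s => |V s|
  exact ⟨_, hs₀⟩

open Filter Topology

lemma tendsto_add_div (θ c : ℝ) :
    Tendsto (fun T : ℕ => (1 / (T : ℝ)) * (T * θ + c)) atTop (𝓝 θ) := by
  have h1 : Tendsto (fun T : ℕ => θ + c / (T : ℝ)) atTop (𝓝 (θ + 0)) :=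
    tendsto_const_nhds.add (tendsto_const_div_atTop_nhds_zero_nat c)
  rw [add_zero] at h1
  refine h1.congr' ?_
  filter_upwards [eventually_gt_atTop 0] with T hT
  have hT' : (T : ℝ) ≠ 0 := by positivity
  field_simp

namespace IsBellmanSolution

variable {θ : ℝ} {V : State M → ℝ}

lemma le_via_add_actVal (h : IsBellmanSolution M θ V) (s : State M) (a : Bool) :
    θ + V s ≤ via M s + actVal M V a s := by
  rw [h s]
  cases a
  · exact min_le_left _ _
  · exact min_le_right _ _

lemma eq_via_add_actVal_optAction (h : IsBellmanSolution M θ V) (s : State M) :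
    θ + V s = via M s + actVal M V (optAction M V s) s := by
  rw [h s]
  by_cases hs : adv M V s < 0
  · rw [show optAction M V s = true by simpa [optAction] using hs]
    exact min_eq_right (by linarith [show actVal M V true s - actVal M V false s < 0 from hs])
  · rw [show optAction M V s = false by simpa [optAction] using hs]
    exact min_eq_left (by linarith [show 0 ≤ actVal M V true s - actVal M V false s from not_lt.1 hs])

lemma mul_add_le_sum (h : IsBellmanSolution M θ V) (π : Policy M) (s : State M) (T : ℕ) :
    T * θ + V s ≤
      ∑ t ∈ Finset.range T, expVIA M π s t + expect (law M π s T) fun ω => V ω.2 := by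
  induction T with
  | zero => simp [expect_law_zero]
  | succ T ih =>
    have h1 : expect (law M π s T) (fun ω => θ + V ω.2) ≤
        expect (law M π s T) fun ω =>
          via M ω.2 + expect (π T ω.1 ω.2) fun a => actVal M V a ω.2 := by
      refine expect_mono _ fun ω => ?_
      rw [← expect_const (π T ω.1 ω.2) (via M ω.2), ← expect_add,
        ← expect_const (π T ω.1 ω.2) (θ + V ω.2)]
      exact expect_mono _ fun a => h.le_via_add_actVal _ _
    rw [expect_add, expect_add, expect_const, ← expect_law_succ, ← expVIA_eq_expect] at h1
    rw [Finset.sum_range_succ]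
    push_cast
    linarith

lemma mul_add_eq_sum (h : IsBellmanSolution M θ V) (s : State M) (T : ℕ) :
    T * θ + V s = ∑ t ∈ Finset.range T, expVIA M (stationary M (optAction M V)) s t +
      expect (law M (stationary M (optAction M V)) s T) fun ω => V ω.2 := by
  induction T with
  | zero => simp [expect_law_zero]
  | succ T ih =>
    have h1 := expect_law_succ (stationary M (optAction M V)) s T V
    simp only [stationary, expect_pure] at h1
    have h2 : ∀ ω : Hist M T × State M, actVal M V (optAction M V ω.2) ω.2 =
        θ + V ω.2 - via M ω.2 := fun ω => by
      linarith [h.eq_via_add_actVal_optAction ω.2]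
    simp only [h2] at h1
    rw [expect_sub, expect_add, expect_const] at h1
    rw [Finset.sum_range_succ, expVIA_eq_expect]
    unfold stationary at *
    push_cast
    linarith

lemma avgCost_optAction (h : IsBellmanSolution M θ V) (s : State M) :
    avgCost M (stationary M (optAction M V)) s = θ := by
  obtain ⟨B, hB⟩ := exists_abs_le V
  refine Tendsto.limsup_eq ?_
  refine tendsto_of_tendsto_of_tendsto_of_le_of_le (tendsto_add_div θ (V s - B))
    (tendsto_add_div θ (V s + B)) (fun T => ?_) fun T => ?_
  all_goals
    have h1 := h.mul_add_eq_sum s T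
    refine mul_le_mul_of_nonneg_left ?_ (by positivity)
  · have h2 := expect_mono (law M (stationary M (optAction M V)) s T)
      fun ω => (abs_le.1 (hB ω.2)).2
    rw [expect_const] at h2
    linarith
  · have h2 := expect_mono (law M (stationary M (optAction M V)) s T)
      fun ω => (abs_le.1 (hB ω.2)).1
    rw [expect_const] at h2
    linarith

lemma le_avgCost (h : IsBellmanSolution M θ V) (π : Policy M) (s : State M) :
    θ ≤ avgCost M π s := by
  obtain ⟨B, hB⟩ := exists_abs_le V
  have hlim := tendsto_add_div θ (V s - B)
  rw [← hlim.limsup_eq]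
  refine limsup_le_limsup (Eventually.of_forall fun T => ?_) hlim.isCoboundedUnder_le ?_
  · refine mul_le_mul_of_nonneg_left ?_ (by positivity)
    have h1 := h.mul_add_le_sum π s T
    have h2 := expect_mono (law M π s T) fun ω => (abs_le.1 (hB ω.2)).2
    rw [expect_const] at h2
    linarith
  · refine isBoundedUnder_of ⟨M.D, fun T => ?_⟩
    have h1 : ∑ t ∈ Finset.range T, expVIA M π s t ≤ T * M.D := by
      simpa using Finset.sum_le_card_nsmul (Finset.range T) _ _ fun t _ => expVIA_le π s t
    rcases T.eq_zero_or_pos with rfl | hT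
    · simp
    · rw [one_div, inv_mul_le_iff₀ (by positivity)]
      exact h1

end IsBellmanSolution

/-! ### Existence of a Bellman solution by vanishing discount -/

lemma actVal_sub (V W : State M → ℝ) (a : Bool) (s : State M) :
    actVal M V a s - actVal M W a s = actVal M (fun s => V s - W s) a s :=
  (expect_sub _ _ _).symm

lemma abs_actVal_sub_le {V W : State M → ℝ} {m : ℝ} (h : ∀ s, |V s - W s| ≤ m) (a : Bool)
    (s : State M) : |actVal M V a s - actVal M W a s| ≤ m := by
  have h1 := expect_mono (trans M s a) fun s => (abs_le.1 (h s)).1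
  have h2 := expect_mono (trans M s a) fun s => (abs_le.1 (h s)).2
  rw [expect_const] at h1 h2
  rw [actVal_sub]
  exact abs_le.2 ⟨h1, h2⟩

/-- The discounted Bellman operator is a contraction, so it has a fixed point. -/
lemma exists_discounted {γ : ℝ} (hγ0 : 0 ≤ γ) (hγ1 : γ < 1) :
    ∃ V : State M → ℝ, IsDiscountedSolution M γ 0 V := by
  let F : (State M → ℝ) → State M → ℝ := fun V s =>
    min (via M s + γ * actVal M V false s) (via M s + γ * actVal M V true s)
  have hF : ContractingWith ⟨γ, hγ0⟩ F := by
    refine ⟨hγ1, LipschitzWith.of_dist_le_mul fun V W => ?_⟩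
    refine (dist_pi_le_iff (by positivity)).2 fun s => ?_
    have hVW : ∀ s, |V s - W s| ≤ dist V W := fun s => by
      rw [← Real.dist_eq]
      exact dist_le_pi_dist V W s
    have hab : ∀ a, |via M s + γ * actVal M V a s - (via M s + γ * actVal M W a s)| ≤
        γ * dist V W := fun a => by
      rw [add_sub_add_left_eq_sub, ← mul_sub, abs_mul, abs_of_nonneg hγ0]
      exact mul_le_mul_of_nonneg_left (abs_actVal_sub_le hVW a s) hγ0
    rw [Real.dist_eq]
    exact (abs_min_sub_min_le_max _ _ _ _).trans (max_le (hab _) (hab _))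
  refine ⟨hF.fixedPoint, fun s => ?_⟩
  rw [zero_add]
  exact (congrFun hF.fixedPoint_isFixedPt s).symm

lemma flipProb_le_one (x : Bool) : (flipProb M x : ℝ) ≤ 1 := (flipProb M x).2.2

namespace IsDiscountedSolution

variable {γ r : ℝ} {V : State M → ℝ}

lemma nonneg (h : IsDiscountedSolution M γ 0 V) (hγ0 : 0 ≤ γ) (hγ1 : γ < 1) (s : State M) :
    0 ≤ V s := by
  obtain ⟨s₀, hs₀⟩ := Finite.exists_min V
  refine le_trans ?_ (hs₀ s)
  have h1 : ∀ a, V s₀ ≤ actVal M V a s₀ := fun a => by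
    rw [actVal_eq_expect, ← expect_const (trans M s₀ a) (V s₀)]
    exact expect_mono _ hs₀
  have h2 : γ * V s₀ ≤ 0 + V s₀ := by
    rw [h s₀]
    refine le_min ?_ ?_ <;>
    linarith [mul_le_mul_of_nonneg_left (h1 true) hγ0, mul_le_mul_of_nonneg_left (h1 false) hγ0,
      via_nonneg s₀]
  nlinarith

lemma one_sub_mul_le (h : IsDiscountedSolution M γ 0 V) (hγ0 : 0 ≤ γ) (hγ1 : γ < 1) (s : State M) :
    (1 - γ) * V s ≤ M.D := by
  obtain ⟨s₀, hs₀⟩ := Finite.exists_max V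
  have h1 : actVal M V false s₀ ≤ V s₀ := by
    rw [actVal_eq_expect, ← expect_const (trans M s₀ false) (V s₀)]
    exact expect_mono _ hs₀
  have h2 := (h s₀).trans_le (min_le_left _ _)
  have h3 := mul_le_mul_of_nonneg_left (hs₀ s) (sub_nonneg.2 hγ1.le)
  linarith [mul_le_mul_of_nonneg_left h1 hγ0, via_le s₀]

/-- Copying the actions of a state with smaller VIA from a state with VIA `D` costs at most `D`
more per slot until a transmission succeeds or the smaller VIA has reached `D`; each flip of the
source brings it closer to `D`, whatever the actions. -/
lemma ext_cap_sub_le (h : IsDiscountedSolution M γ 0 V) (hγ0 : 0 ≤ γ) (hγ1 : γ < 1) (hr0 : 0 < r)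
    (hr : ∀ x, r ≤ flipProb M x) (j : ℕ) : ∀ e x d, M.D ≤ d + j →
      ext V e x M.D - ext V e x d ≤ j * (M.D / r) := by
  induction j with
  | zero =>
    intro e x d hd
    rw [ext_congr V (d := d) (d' := M.D) x rfl (by omega)]
    simp
  | succ j ih =>
    intro e x d hd
    obtain ⟨e₀, x₀, -, he₀, hmax⟩ := exists_max_of_cap M.E M.D
      (fun e x _ => ext V e x M.D - ext V e x d) fun _ _ _ => rfl
    set m := ext V e₀ x₀ M.D - ext V e₀ x₀ d with hm
    replace hmax : ∀ e x, ext V e x M.D - ext V e x d ≤ m := fun e x => by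
      rw [ext_congr V (e := e) (e' := min e M.E) x (by simp) (rfl : min d M.D = _),
        ext_congr V (e := e) (e' := min e M.E) x (by simp) (rfl : min M.D M.D = _)]
      exact hmax _ _ 0 (min_le_right _ _)
    refine (hmax e x).trans ?_
    set C : ℝ := j * (M.D / r) with hC
    have hC0 : 0 ≤ C := by positivity
    have hCs : ((j + 1 : ℕ) : ℝ) * (M.D / r) = C + M.D / r := by push_cast; ring
    rw [hCs]
    have hD0 : 0 ≤ M.D / r := by positivity
    by_contra! hlt
    have hCm : C < m := by linarith
    -- The coupled difference after one slot, once the two VIAs have been raised by the flip `c`.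
    have hstep : ∀ e, ∀ b c : Bool, ext V (e + b.toNat) (xor x₀ c) (M.D + c.toNat) -
        ext V (e + b.toNat) (xor x₀ c) (d + c.toNat) ≤ if c then C else m := by
      intro e b c
      rw [ext_congr V (d := M.D + c.toNat) (d' := M.D) _ rfl (by omega)]
      cases c
      · simpa using hmax _ _
      · simpa using ih (e + b.toNat) (!x₀) (d + 1) (by omega)
    have hmean : ∀ g : Bool → Bool → ℝ, (∀ b c, g b c ≤ if c then C else m) →
        slotMean M x₀ g ≤ m - r * (m - C) := by
      intro g hg
      refine (slotMean_le_flip (m₀ := m) (m₁ := C) (fun b => by simpa using hg b false)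
        (fun b => by simpa using hg b true)).trans ?_
      nlinarith [hr x₀]
    have hr1 : r ≤ 1 := (hr x₀).trans (flipProb_le_one x₀)
    have hpos : 0 ≤ m - r * (m - C) := by nlinarith
    have hcost : ((min M.D M.D : ℕ) : ℝ) - (min d M.D : ℕ) ≤ M.D := by simp
    have hfin : m ≤ M.D + (m - r * (m - C)) → False := by
      intro h1
      have h2 : m - C ≤ M.D / r := by
        rw [le_div_iff₀ hr0]
        linarith
      linarith
    apply hfin
    rcases h.cases_action he₀ x₀ d with h1 | ⟨n, rfl, h1⟩
    · have h2 := h.le_idle he₀ x₀ M.D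
      have h3 : idleVal V e₀ x₀ M.D - idleVal V e₀ x₀ d ≤ m - r * (m - C) := by
        rw [idleVal, idleVal, ← slotMean_sub]
        exact hmean _ fun b c => hstep e₀ b c
      have h4 := mul_le_mul_of_nonneg_left h3 hγ0
      have h5 := mul_le_of_le_one_left hpos hγ1.le
      linarith
    · have h2 := h.le_send he₀ x₀ M.D
      have h3 : sendVal V n x₀ M.D - sendVal V n x₀ d ≤ m - r * (m - C) := by
        rw [sendVal, sendVal, ← slotMean_sub]
        refine hmean _ fun b c => ?_
        have h6 := hstep n b c
        have h7 : (0 : ℝ) ≤ if c then C else m := by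
          split_ifs <;> linarith
        have h8 := mul_le_mul_of_nonneg_left h6 (one_sub_ps_nonneg (M := M))
        have h9 := mul_nonneg (ps_nonneg (M := M)) h7
        linarith
      have h4 := mul_le_mul_of_nonneg_left h3 hγ0
      have h5 := mul_le_of_le_one_left hpos hγ1.le
      linarith

/-- The value of one unit of energy is bounded: copying the actions of the fuller battery costs
nothing until the emptier one cannot transmit, and then the levels agree. -/
lemma ext_sub_ext_succ_le (h : IsDiscountedSolution M γ 0 V) (hγ0 : 0 ≤ γ) (hγ1 : γ < 1) {C : ℝ}
    (hC0 : 0 ≤ C) (hC : ∀ e x d d', ext V e x d - ext V e x d' ≤ C) (e : ℕ) (x : Bool) (d : ℕ) :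
    ext V e x d - ext V (e + 1) x d ≤ C := by
  obtain ⟨e₀, x₀, d₀, he₀, hmax⟩ := exists_max_of_cap M.E M.D
    (fun e x d => ext V e x d - ext V (e + 1) x d) fun e x d => by
      rw [ext_congr V (d := min d M.D) (d' := d) x rfl (by simp),
        ext_congr V (d := min d M.D) (d' := d) x rfl (by simp)]
  set m := ext V e₀ x₀ d₀ - ext V (e₀ + 1) x₀ d₀ with hm
  replace hmax : ∀ e x d, ext V e x d - ext V (e + 1) x d ≤ m := fun e x d => by
    rw [ext_congr V (e := e) (e' := min e M.E) x (by simp) (rfl : min d M.D = _),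
      ext_congr V (e := e + 1) (e' := min e M.E + 1) x (by omega) (rfl : min d M.D = _)]
    exact hmax _ _ _ (min_le_right _ _)
  refine (hmax e x d).trans ?_
  by_contra! hlt
  have hE : e₀ + 1 ≤ M.E := by
    by_contra! hE
    rw [hm, ext_congr V (e := e₀ + 1) (e' := e₀) x₀ (by omega) rfl, sub_self] at hlt
    linarith
  have hm0 : 0 < m := hC0.trans_lt hlt
  have hγm : γ * m < m := mul_lt_of_lt_one_left hm0 hγ1
  have hp0 := ps_nonneg (M := M)
  have hf0 := one_sub_ps_nonneg (M := M)
  have h2 := h.le_idle he₀ x₀ d₀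
  rcases h.cases_action hE x₀ d₀ with h1 | ⟨n, hn, h1⟩
  · have h3 : idleVal V e₀ x₀ d₀ - idleVal V (e₀ + 1) x₀ d₀ ≤ m := by
      rw [idleVal, idleVal, ← slotMean_sub]
      refine slotMean_le fun b c => ?_
      rw [add_right_comm e₀ 1]
      exact hmax _ _ _
    linarith [mul_le_mul_of_nonneg_left h3 hγ0]
  · obtain rfl : e₀ = n := by omega
    rcases e₀ with _ | k
    · have h3 : idleVal V 0 x₀ d₀ - sendVal V 0 x₀ d₀ ≤ m := by
        rw [idleVal, sendVal, ← slotMean_sub]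
        refine slotMean_le fun b c => ?_
        have h4 := hC (0 + b.toNat) (xor x₀ c) (d₀ + c.toNat) c.toNat
        nlinarith
      linarith [mul_le_mul_of_nonneg_left h3 hγ0]
    · have h2 := h.le_send he₀ x₀ d₀
      have h3 : sendVal V k x₀ d₀ - sendVal V (k + 1) x₀ d₀ ≤ m := by
        rw [sendVal, sendVal, ← slotMean_sub]
        refine slotMean_le fun b c => ?_
        rw [add_right_comm k 1]
        have h5 := mul_le_mul_of_nonneg_left (hmax (k + b.toNat) (xor x₀ c) c.toNat) hp0
        have h6 := mul_le_mul_of_nonneg_left (hmax (k + b.toNat) (xor x₀ c) (d₀ + c.toNat)) hf0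
        linarith
      linarith [mul_le_mul_of_nonneg_left h3 hγ0]

/-- For each source state the value is largest at battery level `0` and VIA `D`; from there, waiting
for a flip of the source bounds the effect of the source state. -/
lemma ext_zero_cap_sub_le (h : IsDiscountedSolution M γ 0 V) (hγ0 : 0 ≤ γ) (hγ1 : γ < 1)
    (hβ1 : M.β < 1) (hr0 : 0 < r) (hr : ∀ x, r ≤ flipProb M x) (x x' : Bool) :
    ext V 0 x M.D - ext V 0 x' M.D ≤ M.D / r := by
  have hD0 : 0 ≤ M.D / r := by positivity
  rcases eq_or_ne x' x with rfl | hx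
  · rwa [sub_self]
  obtain rfl : x' = !x := Bool.eq_not.2 hx
  by_contra! hlt
  have h1 := h.zero_eq x M.D
  rw [min_self, zero_add] at h1
  have hle : ∀ (b : Bool) y d, ext V (0 + b.toNat) y (M.D + d) ≤ ext V 0 y M.D := fun b y d =>
    (h.antitone_ext hγ0 hγ1.le hβ1 y _ (Nat.zero_le _)).trans_eq (ext_congr V y rfl (by omega))
  have h2 : idleVal V 0 x M.D ≤
      flipProb M x * ext V 0 (!x) M.D + (1 - flipProb M x) * ext V 0 x M.D := by
    refine slotMean_le_flip (fun b => ?_) fun b => ?_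
    · simpa using hle b x 0
    · simpa using hle b (!x) 1
  have h3 : 0 ≤ idleVal V 0 x M.D := by
    have h4 := slotMean_mono (M := M) x (g := fun _ _ => 0)
      (k := fun b c => ext V (0 + b.toNat) (xor x c) (M.D + c.toNat))
      fun b c => h.nonneg hγ0 hγ1 _
    refine le_of_eq_of_le ?_ h4
    simp [slotMean]
  have h5 := mul_le_of_le_one_left h3 hγ1.le
  have h6 := (div_lt_iff₀ hr0).1 hlt
  nlinarith [hr x]

/-- The span of the discounted value functions is bounded uniformly in the discount factor. -/
lemma sub_le_span (h : IsDiscountedSolution M γ 0 V) (hγ0 : 0 ≤ γ) (hγ1 : γ < 1)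
    (hβ1 : M.β < 1) (hr0 : 0 < r) (hr : ∀ x, r ≤ flipProb M x) (s s' : State M) :
    V s - V s' ≤ M.D / r + M.E * (M.D * (M.D / r)) + M.D * (M.D / r) := by
  set C : ℝ := M.D * (M.D / r) with hC
  have hC0 : 0 ≤ C := by positivity
  have hle : ∀ e x d, ext V e x d ≤ ext V e x M.D := fun e x d => by
    rw [ext_congr V (d := d) (d' := min d M.D) x rfl (by simp)]
    exact h.monotone_ext hγ0 hγ1.le e x (min_le_right _ _)
  have hCd : ∀ e x d d', ext V e x d - ext V e x d' ≤ C := fun e x d d' => by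
    have h1 := h.ext_cap_sub_le hγ0 hγ1 hr0 hr M.D e x 0 (by omega)
    have h2 := h.monotone_ext hγ0 hγ1.le e x (Nat.zero_le d')
    linarith [hle e x d]
  have htel : ∀ (e : ℕ) x d, ext V 0 x d - ext V e x d ≤ e * C := by
    intro e x d
    induction e with
    | zero => simp
    | succ e ih =>
      have h1 := h.ext_sub_ext_succ_le hγ0 hγ1 hC0 hCd e x d
      push_cast
      linarith
  obtain ⟨e, x, d⟩ := s
  obtain ⟨e', x', d'⟩ := s'
  rw [← ext_coe V e, ← ext_coe V e']
  have h1 := h.antitone_ext hγ0 hγ1.le hβ1 x d (Nat.zero_le e)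
  have h2 := h.antitone_ext hγ0 hγ1.le hβ1 x' d' (Nat.le_of_lt_succ e'.2)
  have h3 := h.ext_zero_cap_sub_le hγ0 hγ1 hβ1 hr0 hr x x'
  simp only at h1 h2
  linarith [hle 0 x d, htel M.E x' M.D, hCd M.E x' M.D d']

end IsDiscountedSolution

/-- Along a sequence of discount factors tending to `1`, the value functions normalized at one
state stay in a compact box; a limit point solves the average-cost equation. -/
lemma exists_isBellmanSolution (hp : 0 < M.p) (hq : 0 < M.q) (hβ1 : M.β < 1) :
    ∃ (θ : ℝ) (V : State M → ℝ), IsBellmanSolution M θ V := by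
  obtain ⟨r, hr0, hr⟩ : ∃ r : ℝ, 0 < r ∧ ∀ x, r ≤ flipProb M x := by
    refine ⟨min M.p M.q, lt_min hp hq, fun x => ?_⟩
    cases x
    · exact min_le_left _ _
    · exact min_le_right _ _
  set C : ℝ := M.D / r + M.E * (M.D * (M.D / r)) + M.D * (M.D / r) with hC
  let γ : ℕ → ℝ := fun n => 1 - 1 / ((n : ℝ) + 1)
  have hγ0 : ∀ n, 0 ≤ γ n := fun n => by
    have h1 : 1 / ((n : ℝ) + 1) ≤ 1 := by
      rw [div_le_one (by positivity)]
      linarith [Nat.cast_nonneg (α := ℝ) n]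
    linarith
  have hγ1 : ∀ n, γ n < 1 := fun n => sub_lt_self _ (by positivity)
  have hγ : Tendsto γ atTop (𝓝 1) := by
    simpa [γ] using (tendsto_const_nhds (x := (1 : ℝ))).sub
      (tendsto_one_div_add_atTop_nhds_zero_nat (𝕜 := ℝ))
  choose V hV using fun n => exists_discounted (M := M) (hγ0 n) (hγ1 n)
  let s₀ : State M := (0, false, 0)
  let u : ℕ → ℝ × (State M → ℝ) := fun n => ((1 - γ n) * V n s₀, fun s => V n s - V n s₀)
  have hu : ∀ n, u n ∈ Set.Icc 0 (M.D : ℝ) ×ˢ Set.univ.pi fun _ : State M => Set.Icc (-C) C := by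
    refine fun n => ⟨⟨mul_nonneg (sub_nonneg.2 (hγ1 n).le) ((hV n).nonneg (hγ0 n) (hγ1 n) s₀),
      (hV n).one_sub_mul_le (hγ0 n) (hγ1 n) s₀⟩, fun s _ => ⟨?_, ?_⟩⟩
    · have h1 := (hV n).sub_le_span (hγ0 n) (hγ1 n) hβ1 hr0 hr s₀ s
      simp only [u]
      linarith
    · exact (hV n).sub_le_span (hγ0 n) (hγ1 n) hβ1 hr0 hr s s₀
  obtain ⟨⟨θ, W⟩, -, φ, hφ, hlim⟩ :=
    (isCompact_Icc.prod (isCompact_univ_pi fun _ => isCompact_Icc)).tendsto_subseq hu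
  have hθ : Tendsto (fun n => (u (φ n)).1) atTop (𝓝 θ) := (continuous_fst.tendsto _).comp hlim
  have hW : Tendsto (fun n => (u (φ n)).2) atTop (𝓝 W) := (continuous_snd.tendsto _).comp hlim
  have hγφ : Tendsto (fun n => γ (φ n)) atTop (𝓝 1) := hγ.comp hφ.tendsto_atTop
  refine ⟨θ, W, fun s => ?_⟩
  have hact : ∀ a, Tendsto (fun n => via M s + γ (φ n) * actVal M (u (φ n)).2 a s) atTop
      (𝓝 (via M s + actVal M W a s)) := fun a => by
    have hcont : Continuous fun V : State M → ℝ => actVal M V a s := by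
      unfold actVal
      fun_prop
    simpa using tendsto_const_nhds.add (hγφ.mul ((hcont.tendsto W).comp hW))
  refine tendsto_nhds_unique (hθ.add ((continuous_apply s).tendsto W |>.comp hW)) ?_
  refine ((hact false).min (hact true)).congr fun n => ?_
  have hshift : ∀ a, actVal M (u (φ n)).2 a s = actVal M (V (φ n)) a s - V (φ n) s₀ := fun a => by
    simp only [u, actVal_eq_expect, expect_sub, expect_const]
  have h1 := hV (φ n) s
  rw [hshift, hshift]
  have h2 : ∀ a, via M s + γ (φ n) * (actVal M (V (φ n)) a s - V (φ n) s₀) =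
      via M s + γ (φ n) * actVal M (V (φ n)) a s - γ (φ n) * V (φ n) s₀ := fun a => by ring
  rw [h2, h2, min_sub_sub_right, ← h1]
  simp only [u, Function.comp_apply]
  ring

end VIA

theorem theorem1 (M : VIA.Params) (hD : 1 ≤ M.D)
    (hp : 0 < M.p) (hq : 0 < M.q) (hβ0 : 0 < M.β) (hβ1 : M.β < 1) :
    (∃ (θ : ℝ) (V : VIA.State M → ℝ), VIA.IsBellmanSolution M θ V) ∧
    ∀ (θ : ℝ) (V : VIA.State M → ℝ), VIA.IsBellmanSolution M θ V →
      -- the policy chosen by the value function is optimal, with average cost `θ` everywhere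
      VIA.IsOptimal M (VIA.stationary M (VIA.optAction M V)) ∧
      (∀ s : VIA.State M, VIA.avgCost M (VIA.stationary M (VIA.optAction M V)) s = θ) ∧
      -- it is a threshold policy
      VIA.IsThreshold M (VIA.optAction M V) ∧
      -- idling is optimal when the battery is empty or the VIA is zero
      (∀ (x : Bool) (δ : Fin (M.D + 1)), VIA.adv M V (0, x, δ) = 0) ∧
      (∀ (e : Fin (M.E + 1)) (x : Bool), 0 ≤ VIA.adv M V (e, x, 0)) ∧
      -- the advantage is non-increasing in the VIA
      (∀ (e : Fin (M.E + 1)) (x : Bool),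
        Antitone fun δ : Fin (M.D + 1) => VIA.adv M V (e, x, δ)) := by
  refine ⟨VIA.exists_isBellmanSolution hp hq hβ1, fun θ V h => ⟨fun s π => ?_,
    h.avgCost_optAction, h.isThreshold hβ0 hβ1, VIA.adv_zero V,
    h.adv_nonneg hβ1, h.adv_antitone hβ0 hβ1⟩⟩
  rw [h.avgCost_optAction]
  exact h.le_avgCost π s
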